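/- Let $H$ be a real Hilbert space and $\Gamma_0(H)$ the set of proper, lower semicontinuous, convex functions $H\to\mathbb R\cup\{+\infty\}$. Let $f:\mathbb R_+\times H\to\mathbb R\cup\{+\infty\}$ be such that $f(t,\cdot)\in\Gamma_0(H)$ for all $t\ge 0$, let $x\in H$ be such that $f(t,x)\in\mathbb R$ for all $t\ge 0$, and let $v\in\partial f(0,\cdot)(x)$, where $\partial$ denotes the convex subdifferential. For $\tau>0$ and $w\in H$ put $$\Delta^2_\tau f(x|v)(w):=\frac{f(\tau,x+\tau w)-f(\tau,x)-\tau\langle v,w\rangle}{\tau^2}.$$ Write $\mathrm{Epi}(g):=\{(w,\lambda)\in H\times\mathbb R: g(w)\le\lambda\}$. Below, $(t_n)$ denotes sequences of positive reals. A family $(S_\tau)_{\tau>0}$ of subsets of $H\times\mathbb R$ is Mosco convergent (as $\tau\to0$) if $\text{w-}\limsup S_\tau\subset\liminf S_\tau$, where $\text{w-}\limsup S_\tau$ is the set of $p$ for which there are $t_n\to0$ and $p_n\rightharpoonup p$ weakly with $p_n\in S_{t_n}$ for all $n$, and $\liminf S_\tau$ is the set of $p$ such that for every $t_n\to0$ there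 is $p_n\to p$ strongly with $p_n\in S_{t_n}$ for all large $n$; these two sets are then equal, and are called the Mosco limit. The function $f$ is twice epi-differentiable at $x$ for $v$ if $(\mathrm{Epi}(\Delta^2_\tau f(x|v)))_{\tau>0}$ is Mosco convergent; its second epi-derivative $d^2_ef(x|v):H\to[-\infty,+\infty]$ is then the function whose epigraph is the Mosco limit. A family $(g_\tau)_{\tau>0}$ in $\Gamma_0(H)$ admits a convergent supporting hyperplane if there are $(z_\tau,\xi_\tau,\beta_\tau)\in H\times H\times\mathbb R$, $\tau>0$, converging strongly in $H\times H\times\mathbb R$ as $\tau\to0$, such that for every $\tau>0$ one has $g_\tau(w)\ge\langle\xi_\tau,w\rangle+\beta_\tau$ for all $w\in H$ and $g_\tau(z_\tau)=\langle\xi_\tau,z_\tau\rangle+\beta_\tau$. **Proposition.** If $f$ is twice epi-differentiable at $x$ for $v$, then the following assertions are equivalent: (i) $d^2_ef(x|v)\in\Gamma_0(H)$; (ii) the family $(\Delta^2_\tau f(x|v))_{\tau>0}$ admits a convergent supporting hyperplane. -/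

import Mathlib

open Filter Topology

namespace EpiDiff

/-! ### Limits of families of sets as `τ → 0`, `τ > 0`

Families indexed by `τ > 0` are functions on `ℝ` of which only the values at positive reals
are used. -/

section SetLimits

variable {E : Type*} [NormedAddCommGroup E]

/-- Sequences of positive parameters tending to `0`. -/
def PosNull (t : ℕ → ℝ) : Prop :=
  (∀ n, 0 < t n) ∧ Tendsto t atTop (𝓝 0)

/-- Weak convergence of a sequence in a normed space. -/
def WeakTendsto [NormedSpace ℝ E] (u : ℕ → E) (p : E) : Prop :=
  Tendsto (fun n => toWeakSpace ℝ E (u n)) atTop (𝓝 (toWeakSpace ℝ E p))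

/-- The (strong) inner limit `liminf S_τ`. -/
def innerLimit (S : ℝ → Set E) : Set E :=
  {p | ∀ t : ℕ → ℝ, PosNull t →
    ∃ u : ℕ → E, Tendsto u atTop (𝓝 p) ∧ ∃ N : ℕ, ∀ n ≥ N, u n ∈ S (t n)}

/-- The weak-outer limit `w-limsup S_τ`. -/
def weakOuterLimit [NormedSpace ℝ E] (S : ℝ → Set E) : Set E :=
  {p | ∃ t : ℕ → ℝ, PosNull t ∧
    ∃ u : ℕ → E, WeakTendsto u p ∧ ∀ n, u n ∈ S (t n)}

/-- Mosco convergence of a family of sets. -/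
def MoscoConvergent [NormedSpace ℝ E] (S : ℝ → Set E) : Prop :=
  weakOuterLimit S ⊆ innerLimit S

theorem weakTendsto_of_tendsto [NormedSpace ℝ E] {u : ℕ → E} {p : E} (h : Tendsto u atTop (𝓝 p)) :
    WeakTendsto u p :=
  ((toWeakSpaceCLM ℝ E).continuous.tendsto p).comp h

/-- The inner limit is always contained in the weak-outer limit, so for a Mosco convergent family
they coincide; their common value is the Mosco limit. -/
theorem MoscoConvergent.innerLimit_eq [NormedSpace ℝ E] {S : ℝ → Set E} (h : MoscoConvergent S) :
    innerLimit S = weakOuterLimit S := by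
  refine Set.Subset.antisymm (fun p hp => ?_) h
  have ht : PosNull (fun n : ℕ => 1 / ((n : ℝ) + 1)) :=
    ⟨fun n => by positivity, tendsto_one_div_add_atTop_nhds_zero_nat⟩
  obtain ⟨u, hu, N, hN⟩ := hp _ ht
  refine ⟨fun n => 1 / (((n + N : ℕ) : ℝ) + 1), ⟨fun n => by positivity, ?_⟩,
    fun n => u (n + N), weakTendsto_of_tendsto ((tendsto_add_atTop_iff_nat N).2 hu),
    fun n => hN _ (Nat.le_add_left _ _)⟩
  exact (tendsto_add_atTop_iff_nat N).2 ht.2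

theorem isClosed_innerLimit (S : ℝ → Set E) : IsClosed (innerLimit S) := by
  refine isClosed_of_closure_subset fun p hp t ht => ?_
  have key : ∀ ε > 0, ∀ᶠ n in atTop, ∃ q ∈ S (t n), dist q p < ε := by
    intro ε hε
    obtain ⟨q, hq, hpq⟩ := Metric.mem_closure_iff.1 hp (ε / 2) (half_pos hε)
    obtain ⟨u, hu, N, hN⟩ := hq t ht
    filter_upwards [eventually_ge_atTop N, Metric.tendsto_nhds.1 hu (ε / 2) (half_pos hε)]
      with n hn hd
    refine ⟨u n, hN n hn, ?_⟩
    have := dist_triangle (u n) q p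
    rw [dist_comm q p] at this
    linarith
  have hne : ∀ n, ∃ q : E, (S (t n)).Nonempty →
      q ∈ S (t n) ∧ dist p q < Metric.infDist p (S (t n)) + 1 / ((n : ℝ) + 1) := by
    intro n
    by_cases hn : (S (t n)).Nonempty
    · obtain ⟨q, hq, hd⟩ := (Metric.infDist_lt_iff hn (x := p)
        (r := Metric.infDist p (S (t n)) + 1 / ((n : ℝ) + 1))).1
        (lt_add_of_pos_right _ (by positivity))
      exact ⟨q, fun _ => ⟨hq, hd⟩⟩
    · exact ⟨p, fun h => absurd h hn⟩
  choose u hu using hne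
  refine ⟨u, ?_, ?_⟩
  · refine Metric.tendsto_nhds.2 fun ε hε => ?_
    have h1 : ∀ᶠ n : ℕ in atTop, 1 / ((n : ℝ) + 1) < ε / 2 :=
      tendsto_one_div_add_atTop_nhds_zero_nat.eventually (gt_mem_nhds (half_pos hε))
    filter_upwards [key (ε / 2) (half_pos hε), h1] with n ⟨q, hq, hd⟩ h2
    have h3 := (hu n ⟨q, hq⟩).2
    have h4 : Metric.infDist p (S (t n)) ≤ dist p q := Metric.infDist_le_dist_of_mem hq
    rw [dist_comm p q] at h4
    rw [dist_comm]
    linarith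
  · obtain ⟨N, hN⟩ := eventually_atTop.1 (key 1 one_pos)
    refine ⟨N, fun n hn => ?_⟩
    obtain ⟨q, hq, -⟩ := hN n hn
    exact (hu n ⟨q, hq⟩).1

end SetLimits

/-! ### Extended-real-valued functions -/

section Functions

variable {H : Type*} [NormedAddCommGroup H] [InnerProductSpace ℝ H]

/-- The epigraph of an extended-real-valued function, a subset of `H × ℝ`. -/
def epi (f : H → EReal) : Set (H × ℝ) :=
  {p | f p.1 ≤ (p.2 : EReal)}

/-- The class `Γ₀(H)` of proper, lower semicontinuous, convex functions `H → ℝ ∪ {+∞}`. -/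
structure IsGammaZero (f : H → EReal) : Prop where
  ne_bot : ∀ x, f x ≠ ⊥
  proper : ∃ x, f x < ⊤
  lsc : IsClosed (epi f)
  convex : Convex ℝ (epi f)

/-- The class `Γ₀(·, H)` of functions `ℝ₊ × H → ℝ ∪ {+∞}` with `f(t, ·) ∈ Γ₀(H)` for every `t ≥ 0`;
only the values at `t ≥ 0` are used. -/
def IsParamGammaZero (f : ℝ → H → EReal) : Prop :=
  ∀ t, 0 ≤ t → IsGammaZero (f t)

/-- The set `f⁻¹(·, ℝ)` of the points at which `f(t, ·)` is finite for every `t ≥ 0`. -/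
def finiteDomain (f : ℝ → H → EReal) : Set H :=
  {x | ∀ t, 0 ≤ t → f t x ≠ ⊥ ∧ f t x ≠ ⊤}

/-- The subdifferential of a function at a point. -/
def subdiff (f : H → EReal) (x : H) : Set H :=
  {y | ∀ z, ((inner ℝ y (z - x) : ℝ) : EReal) ≤ f z - f x}

/-- Mosco (epi-)convergence of a family `(f_τ)_{τ > 0}` of functions. -/
def EpiConvergent (F : ℝ → H → EReal) : Prop :=
  MoscoConvergent fun τ => epi (F τ)

/-- The epi-limit of a family of functions: the function whose epigraph is the limit of the
epigraphs (see `epi_epiLimit`). -/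
noncomputable def epiLimit (F : ℝ → H → EReal) (w : H) : EReal :=
  ⨅ (a : ℝ) (_ : (w, a) ∈ innerLimit fun τ => epi (F τ)), (a : EReal)

theorem epi_epiLimit (F : ℝ → H → EReal) :
    epi (epiLimit F) = innerLimit fun τ => epi (F τ) := by
  have mono : ∀ (w : H) (a b : ℝ), a ≤ b → (w, a) ∈ (innerLimit fun τ => epi (F τ)) →
      (w, b) ∈ innerLimit fun τ => epi (F τ) := by
    intro w a b hab h t ht
    obtain ⟨u, hu, N, hN⟩ := h t ht
    refine ⟨fun n => u n + (0, b - a), ?_, N, fun n hn => ?_⟩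
    · simpa using hu.add_const ((0 : H), b - a)
    · have h1 : F (t n) (u n).1 ≤ ((u n).2 : EReal) := hN n hn
      have h2 : (u n).2 ≤ (u n).2 + (b - a) := by linarith
      have h3 : F (t n) (u n).1 ≤ (((u n).2 + (b - a) : ℝ) : EReal) :=
        h1.trans (EReal.coe_le_coe_iff.2 h2)
      simpa [epi] using h3
  ext ⟨w, a⟩
  constructor
  · intro h
    have h : epiLimit F w ≤ (a : EReal) := h
    have hlt : ∀ n : ℕ, (w, a + 1 / ((n : ℝ) + 1)) ∈ innerLimit fun τ => epi (F τ) := by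
      intro n
      have hn : a < a + 1 / ((n : ℝ) + 1) := lt_add_of_pos_right _ (by positivity)
      have h' := h.trans_lt (EReal.coe_lt_coe_iff.2 hn)
      simp only [epiLimit, iInf_lt_iff] at h'
      obtain ⟨b, hb, hlt⟩ := h'
      exact mono w b _ (EReal.coe_lt_coe_iff.1 hlt).le hb
    refine (isClosed_innerLimit _).mem_of_tendsto (b := atTop) ?_ (Eventually.of_forall hlt)
    refine tendsto_const_nhds.prodMk_nhds ?_
    simpa using tendsto_one_div_add_atTop_nhds_zero_nat.const_add a
  · intro h
    have h' : epiLimit F w ≤ (a : EReal) := iInf₂_le (f := fun (b : ℝ)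
      (_ : (w, b) ∈ innerLimit fun τ => epi (F τ)) => (b : EReal)) a h
    exact h'

/-- The second-order difference quotient
`Δ²_τ f(x|v)(w) = (f(τ, x + τ w) - f(τ, x) - τ ⟨v, w⟩) / τ²`. -/
noncomputable def secondDiffQuot (f : ℝ → H → EReal) (x v : H) (τ : ℝ) (w : H) : EReal :=
  (f τ (x + τ • w) - f τ x - ((τ * inner ℝ v w : ℝ) : EReal)) / ((τ ^ 2 : ℝ) : EReal)

/-- `f` is twice epi-differentiable at `x` for `v`. -/
def TwiceEpiDifferentiableAt (f : ℝ → H → EReal) (x v : H) : Prop :=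
  EpiConvergent (secondDiffQuot f x v)

/-- The second epi-derivative `d²ₑ f(x|v)`. -/
noncomputable def secondEpiDeriv (f : ℝ → H → EReal) (x v : H) : H → EReal :=
  epiLimit (secondDiffQuot f x v)

/-- `(z, ξ, β)` is a supporting hyperplane of `g`. -/
def IsSupportingHyperplane (g : H → EReal) (z ξ : H) (β : ℝ) : Prop :=
  (∀ w, ((inner ℝ ξ w + β : ℝ) : EReal) ≤ g w) ∧ g z = ((inner ℝ ξ z + β : ℝ) : EReal)

/-- The family `(F_τ)_{τ > 0}` admits a convergent supporting hyperplane. -/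
def AdmitsConvergentSupportingHyperplane (F : ℝ → H → EReal) : Prop :=
  ∃ (z ξ : ℝ → H) (β : ℝ → ℝ) (z₀ ξ₀ : H) (β₀ : ℝ),
    Tendsto z (𝓝[>] 0) (𝓝 z₀) ∧ Tendsto ξ (𝓝[>] 0) (𝓝 ξ₀) ∧ Tendsto β (𝓝[>] 0) (𝓝 β₀) ∧
    ∀ τ, 0 < τ → IsSupportingHyperplane (F τ) (z τ) (ξ τ) (β τ)

end Functions

end EpiDiff

/-! For (ii) ⇒ (i), affine minorants with convergent coefficients pass to the limit and exclude the
value `⊥`, while the contact points converge to a point where the limit is finite. Closedness and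
convexity are inherited by any inner limit of convex sets.

For (i) ⇒ (ii), the hyperplane touches each quotient at the proximal point of the origin, the
minimizer of `g + ‖·‖² / 2`. Optimality makes minus this point a subgradient, so it suffices that
the minimizers and their values converge strongly (`MoscoConvergent.tendsto_proxObj_min`). The crux
is a uniform lower bound: were the epigraphs to dip below ever steeper cones, convex combinations
with a recovery sequence would put a whole vertical line in the Mosco limit, against properness
(`MoscoConvergent.exists_eventually_neg_le`). The minimizers are then bounded. A weak cluster point
lies in the limit epigraph, is optimal by comparison with a recovery sequence, hence is its unique
minimizer, and convergence of the energies makes the convergence strong. -/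

namespace EpiDiff

section Hilbert

variable {H : Type*} [NormedAddCommGroup H] [InnerProductSpace ℝ H]

/-! ### Weak convergence -/

/-- Bounded sequences of a Hilbert space have weakly convergent subsequences. -/
theorem exists_subseq_weak_limit [CompleteSpace H] {u : ℕ → H} {R : ℝ} (hu : ∀ n, ‖u n‖ ≤ R) :
    ∃ (p : H) (φ : ℕ → ℕ), StrictMono φ ∧
      ∀ y, Tendsto (fun n => inner ℝ (u (φ n)) y) atTop (𝓝 (inner ℝ p y)) := by
  -- Sequential Banach–Alaoglu needs separability, so the argument runs in the closed span of the
  -- sequence; orthogonal projection then handles test vectors outside it.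
  set M : Submodule ℝ H := (Submodule.span ℝ (Set.range u)).topologicalClosure with hM
  have hMc : IsClosed (M : Set H) := Submodule.isClosed_topologicalClosure _
  have huM : ∀ n, u n ∈ M := fun n =>
    Submodule.le_topologicalClosure _ (Submodule.subset_span ⟨n, rfl⟩)
  have : CompleteSpace M := hMc.completeSpace_coe
  have : TopologicalSpace.SeparableSpace M := by
    have h : TopologicalSpace.IsSeparable (M : Set H) :=
      ((Set.countable_range u).isSeparable.span (R := ℝ)).closure
    exact h.separableSpace
  let g : ℕ → WeakDual ℝ M := fun n =>
    StrongDual.toWeakDual (InnerProductSpace.toDual ℝ M ⟨u n, huM n⟩)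
  have hg : ∀ n, g n ∈ WeakDual.toStrongDual ⁻¹' Metric.closedBall (0 : StrongDual ℝ M) R := by
    intro n
    change InnerProductSpace.toDual ℝ M ⟨u n, huM n⟩ ∈ Metric.closedBall (0 : StrongDual ℝ M) R
    rw [mem_closedBall_zero_iff, LinearIsometryEquiv.norm_map]
    exact hu n
  obtain ⟨l, -, φ, hφ, hl⟩ := WeakDual.isSeqCompact_closedBall ℝ M 0 R hg
  refine ⟨((InnerProductSpace.toDual ℝ M).symm (WeakDual.toStrongDual l) : M), φ, hφ, fun y => ?_⟩
  have h1 := (WeakDual.eval_continuous (M.orthogonalProjectionOnto y)).tendsto l |>.comp hl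
  have h2 : ∀ m : M, inner ℝ (m : H) y = inner ℝ m (M.orthogonalProjectionOnto y) := fun m => by
    rw [Submodule.inner_orthogonalProjectionOnto_eq_of_mem_left]
  rw [h2, InnerProductSpace.toDual_symm_apply]
  refine h1.congr fun n => ?_
  exact (h2 ⟨u (φ n), huM (φ n)⟩).symm

theorem weakTendsto_prodMk [CompleteSpace H] {u : ℕ → H} {a : ℕ → ℝ} {p : H} {c : ℝ}
    (hu : ∀ y, Tendsto (fun n => inner ℝ (u n) y) atTop (𝓝 (inner ℝ p y)))
    (ha : Tendsto a atTop (𝓝 c)) :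
    WeakTendsto (fun n => (u n, a n)) (p, c) := by
  have hind : IsInducing fun (q : WeakSpace ℝ (H × ℝ)) (l : StrongDual ℝ (H × ℝ)) =>
      l ((toWeakSpace ℝ (H × ℝ)).symm q) := ⟨rfl⟩
  refine hind.tendsto_nhds_iff.2 (tendsto_pi_nhds.2 fun l => ?_)
  change Tendsto (fun n => l (u n, a n)) atTop (𝓝 (l (p, c)))
  have h : ∀ (w : H) (b : ℝ), l (w, b) = inner ℝ w ((InnerProductSpace.toDual ℝ H).symm
      (l.comp (ContinuousLinearMap.inl ℝ H ℝ))) + l (0, b) := fun w b => by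
    rw [real_inner_comm, InnerProductSpace.toDual_symm_apply, ContinuousLinearMap.comp_apply,
      ContinuousLinearMap.inl_apply, ← map_add]
    simp
  rw [h p c]
  refine Tendsto.congr (fun n => (h (u n) (a n)).symm) ?_
  exact (hu _).add ((Continuous.tendsto (by fun_prop : Continuous fun b : ℝ => l (0, b)) c).comp ha)

/-- A convex subset of `H × ℝ` with points strongly converging to `p` and points far below the
cones `-n (‖w‖ + 1)` contains points converging to `p.1` and descending to `-∞`. -/
theorem exists_descending_of_far_below {C : ℕ → Set (H × ℝ)} (hC : ∀ n, Convex ℝ (C n))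
    {u w : ℕ → H × ℝ} {p : H × ℝ} (hu : Tendsto u atTop (𝓝 p)) (huC : ∀ᶠ n in atTop, u n ∈ C n)
    (hwC : ∀ n, w n ∈ C n) (hw : ∀ n : ℕ, (w n).2 ≤ -(n * (‖(w n).1‖ + 1))) :
    ∃ q : ℕ → H × ℝ, (∀ᶠ n in atTop, q n ∈ C n) ∧ Tendsto (fun n => (q n).1) atTop (𝓝 p.1) ∧
      Tendsto (fun n => (q n).2) atTop atBot := by
  have hs : Tendsto (fun n : ℕ => √(n : ℝ)) atTop atTop :=
    Real.tendsto_sqrt_atTop.comp tendsto_natCast_atTop_atTop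
  have hs0 : Tendsto (fun n : ℕ => (√(n : ℝ))⁻¹) atTop (𝓝 0) := tendsto_inv_atTop_zero.comp hs
  -- The weight balances two demands: `l n • (w n).1` vanishes, yet `l n * (w n).2` is at most
  -- `-√n`.
  set l : ℕ → ℝ := fun n => (√(n : ℝ))⁻¹ * (‖(w n).1‖ + 1)⁻¹ with hl
  have hpos : ∀ n, 0 < ‖(w n).1‖ + 1 := fun n => by positivity
  have hl0 : ∀ n, 0 ≤ l n := fun n => by positivity
  have hlle : ∀ n, l n ≤ (√(n : ℝ))⁻¹ := fun n =>
    mul_le_of_le_one_right (by positivity) (inv_le_one_of_one_le₀ (by linarith [norm_nonneg (w n).1]))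
  have hlt : Tendsto l atTop (𝓝 0) := squeeze_zero hl0 hlle hs0
  have hlw : Tendsto (fun n => l n • (w n).1) atTop (𝓝 0) := by
    refine squeeze_zero_norm (fun n => ?_) hs0
    rw [norm_smul, Real.norm_of_nonneg (hl0 n), hl]
    have : (‖(w n).1‖ + 1)⁻¹ * ‖(w n).1‖ ≤ 1 := by
      rw [inv_mul_le_iff₀ (hpos n)]; linarith
    calc _ = (√(n : ℝ))⁻¹ * ((‖(w n).1‖ + 1)⁻¹ * ‖(w n).1‖) := by ring
      _ ≤ (√(n : ℝ))⁻¹ := mul_le_of_le_one_right (by positivity) this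
  have hu1 : Tendsto (fun n => (u n).1) atTop (𝓝 p.1) := (continuous_fst.tendsto p).comp hu
  have hu2 : Tendsto (fun n => (u n).2) atTop (𝓝 p.2) := (continuous_snd.tendsto p).comp hu
  have h1l : Tendsto (fun n => 1 - l n) atTop (𝓝 1) := by simpa using hlt.const_sub 1
  refine ⟨fun n => (1 - l n) • u n + l n • w n, ?_, ?_, ?_⟩
  · filter_upwards [huC, hlt.eventually (gt_mem_nhds one_pos)] with n hn hn1
    exact hC n hn (hwC n) (by linarith) (hl0 n) (by ring)
  · simpa using (h1l.smul hu1).add hlw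
  · have h3 : Tendsto (fun n => (1 - l n) * (u n).2 + -√(n : ℝ)) atTop atBot :=
      (h1l.mul hu2).add_atBot (tendsto_neg_atTop_atBot.comp hs)
    refine tendsto_atBot_mono' _ ?_ h3
    filter_upwards [eventually_gt_atTop 0] with n hn
    have hn' : (0 : ℝ) < n := by exact_mod_cast hn
    have : l n * (w n).2 ≤ -√(n : ℝ) := by
      refine (mul_le_mul_of_nonneg_left (hw n) (hl0 n)).trans (le_of_eq ?_)
      have h4 : √(n : ℝ) ≠ 0 := (Real.sqrt_pos.2 hn').ne'
      have h5 := Real.mul_self_sqrt hn'.le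
      have h6 := (hpos n).ne'
      simp only [hl]
      field_simp
      linarith
    simpa using add_le_add_right this ((1 - l n) * (u n).2)

/-! ### Proximal points of convex epigraphs -/

/-- The function `(w, a) ↦ a + ‖w‖² / 2` whose minimizer on an epigraph is given by the proximal
point of the origin. -/
noncomputable def proxObj (p : H × ℝ) : ℝ :=
  p.2 + ‖p.1‖ ^ 2 / 2

omit [InnerProductSpace ℝ H] in
theorem continuous_proxObj : Continuous (proxObj : H × ℝ → ℝ) := by
  unfold proxObj
  fun_prop

theorem proxObj_midpoint (p q : H × ℝ) :
    proxObj ((1 / 2 : ℝ) • p + (1 / 2 : ℝ) • q) =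
      (proxObj p + proxObj q) / 2 - ‖p.1 - q.1‖ ^ 2 / 8 := by
  simp only [proxObj, Prod.fst_add, Prod.snd_add, Prod.smul_fst, Prod.smul_snd, smul_eq_mul,
    ← smul_add, norm_smul, mul_pow, norm_add_sq_real, norm_sub_sq_real]
  norm_num
  ring

/-- By strong convexity, near-minimizers have nearby first components. This yields both uniqueness
of the minimizer and Cauchy minimizing sequences. -/
theorem norm_sub_sq_le_of_forall_proxObj {C : Set (H × ℝ)} (hC : Convex ℝ C) {m : ℝ}
    (hm : ∀ p ∈ C, m ≤ proxObj p) {p q : H × ℝ} (hp : p ∈ C) (hq : q ∈ C) :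
    ‖p.1 - q.1‖ ^ 2 ≤ 4 * ((proxObj p - m) + (proxObj q - m)) := by
  have h := hm _ (hC hp hq one_half_pos.le one_half_pos.le (add_halves (1 : ℝ)))
  rw [proxObj_midpoint] at h
  linarith

theorem eq_of_isMinOn_proxObj {C : Set (H × ℝ)} (hC : Convex ℝ C) {p q : H × ℝ}
    (hp : p ∈ C) (hq : q ∈ C) (hpm : ∀ r ∈ C, proxObj p ≤ proxObj r)
    (hqp : proxObj q ≤ proxObj p) : q = p := by
  have h := norm_sub_sq_le_of_forall_proxObj hC hpm hq hp
  have h0 : ‖q.1 - p.1‖ = 0 := by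
    have : ‖q.1 - p.1‖ ^ 2 ≤ 0 := by linarith
    exact pow_eq_zero_iff two_ne_zero |>.1 (le_antisymm this (by positivity))
  have h1 : q.1 = p.1 := sub_eq_zero.1 (norm_eq_zero.1 h0)
  have h2 := hpm q hq
  simp only [proxObj, h1] at h2 hqp
  exact Prod.ext h1 (by linarith)

theorem exists_isMinOn_proxObj [CompleteSpace H] {C : Set (H × ℝ)} (hC : Convex ℝ C)
    (hcl : IsClosed C) (hne : C.Nonempty) (hb : BddBelow (proxObj '' C)) :
    ∃ p ∈ C, ∀ q ∈ C, proxObj p ≤ proxObj q := by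
  obtain ⟨s, -, hs, hsC⟩ := exists_seq_tendsto_sInf (hne.image proxObj) hb
  set m := sInf (proxObj '' C)
  have hm : ∀ p ∈ C, m ≤ proxObj p := fun p hp => csInf_le hb ⟨p, hp, rfl⟩
  choose u huC hus using hsC
  have hu : Tendsto (fun n => proxObj (u n) - m) atTop (𝓝 0) := by
    simpa [hus] using hs.sub_const m
  have hcau : CauchySeq fun n => (u n).1 := by
    refine Metric.cauchySeq_iff.2 fun ε hε => ?_
    obtain ⟨N, hN⟩ := eventually_atTop.1
      (hu.eventually (gt_mem_nhds (show (0 : ℝ) < ε ^ 2 / 8 by positivity)))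
    refine ⟨N, fun i hi j hj => ?_⟩
    rw [dist_eq_norm]
    refine lt_of_pow_lt_pow_left₀ 2 hε.le ?_
    have := norm_sub_sq_le_of_forall_proxObj hC hm (huC i) (huC j)
    have := hN i hi
    have := hN j hj
    linarith
  obtain ⟨z, hz⟩ := cauchySeq_tendsto_of_complete hcau
  have h2 : Tendsto (fun n => (u n).2) atTop (𝓝 (m - ‖z‖ ^ 2 / 2)) := by
    have h3 : Tendsto (fun n => proxObj (u n)) atTop (𝓝 m) := by simpa [hus] using hs
    refine (h3.sub ((hz.norm.pow 2).div_const 2)).congr fun n => ?_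
    simp [proxObj]
  refine ⟨(z, m - ‖z‖ ^ 2 / 2), hcl.mem_of_tendsto (hz.prodMk_nhds h2)
    (Eventually.of_forall huC), fun q hq => ?_⟩
  simpa [proxObj] using hm q hq

/-- First-order optimality: move from `p` towards `q` by a fraction `t`, divide the increase of
`proxObj` by `t`, and let `t → 0`. -/
theorem inner_add_le_of_isMinOn_proxObj {C : Set (H × ℝ)} (hC : Convex ℝ C) {p : H × ℝ}
    (hp : p ∈ C) (hpm : ∀ r ∈ C, proxObj p ≤ proxObj r) {q : H × ℝ} (hq : q ∈ C) :
    inner ℝ (-p.1) q.1 + (p.2 + ‖p.1‖ ^ 2) ≤ q.2 := by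
  have key : ∀ t : ℝ, 0 < t → t < 1 →
      0 ≤ (q.2 - p.2) + inner ℝ p.1 (q.1 - p.1) + t * (‖q.1 - p.1‖ ^ 2 / 2) := by
    intro t ht ht1
    have h := hpm _ (hC hp hq (by linarith : 0 ≤ 1 - t) ht.le (by ring))
    have e : ((1 - t) • p + t • q).1 = p.1 + t • (q.1 - p.1) := by
      simp only [Prod.fst_add, Prod.smul_fst]; module
    have h1 : proxObj ((1 - t) • p + t • q) = proxObj p +
        t * ((q.2 - p.2) + inner ℝ p.1 (q.1 - p.1) + t * (‖q.1 - p.1‖ ^ 2 / 2)) := by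
      rw [proxObj, e, norm_add_sq_real, inner_smul_right, norm_smul, mul_pow, Real.norm_eq_abs,
        sq_abs, proxObj]
      simp only [Prod.snd_add, Prod.smul_snd, smul_eq_mul]
      ring
    rw [h1] at h
    exact nonneg_of_mul_nonneg_right (by linarith) ht
  have hlim : Tendsto (fun t : ℝ => (q.2 - p.2) + inner ℝ p.1 (q.1 - p.1) +
      t * (‖q.1 - p.1‖ ^ 2 / 2)) (𝓝[>] 0) (𝓝 ((q.2 - p.2) + inner ℝ p.1 (q.1 - p.1) +
      0 * (‖q.1 - p.1‖ ^ 2 / 2))) := by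
    refine tendsto_nhdsWithin_of_tendsto_nhds (Continuous.tendsto ?_ 0)
    fun_prop
  have h := ge_of_tendsto hlim (by
    filter_upwards [Ioo_mem_nhdsGT (one_pos (α := ℝ))] with t ht using key t ht.1 ht.2)
  rw [inner_sub_right, real_inner_self_eq_norm_sq] at h
  rw [inner_neg_left]
  linarith

omit [InnerProductSpace ℝ H] in
theorem neg_le_proxObj {c : ℝ} {p : H × ℝ} (h : -(c * (‖p.1‖ + 1)) ≤ p.2) :
    ‖p.1‖ ^ 2 / 4 - (c ^ 2 + c) ≤ proxObj p := by
  unfold proxObj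
  nlinarith [sq_nonneg (‖p.1‖ - 2 * c)]

/-- A closed convex set containing no downward vertical half-line lies above a cone. -/
theorem exists_forall_neg_le_of_isClosed {C : Set (H × ℝ)} (hC : Convex ℝ C) (hcl : IsClosed C)
    (hne : C.Nonempty) (hup : ∀ w a b, (w, a) ∈ C → a ≤ b → (w, b) ∈ C)
    (hbot : ∀ w, ∃ a, (w, a) ∉ C) :
    ∃ c : ℝ, ∀ p ∈ C, -(c * (‖p.1‖ + 1)) ≤ p.2 := by
  by_contra! hcon
  obtain ⟨p, hp⟩ := hne
  choose w hwC hw using fun n : ℕ => hcon n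
  obtain ⟨q, hqC, hq1, hq2⟩ := exists_descending_of_far_below (C := fun _ => C) (fun _ => hC)
    (tendsto_const_nhds (x := p)) (Eventually.of_forall fun _ => hp) hwC (fun n => (hw n).le)
  obtain ⟨a, ha⟩ := hbot p.1
  refine ha (hcl.mem_of_tendsto (hq1.prodMk_nhds tendsto_const_nhds) ?_)
  filter_upwards [hqC, hq2.eventually (eventually_le_atBot a)] with n h1 h2
  exact hup _ _ _ h1 h2


/-! ### Stability of minimizers under Mosco convergence -/

theorem mem_weakOuterLimit_of_eventually {E : Type*} [NormedAddCommGroup E] [NormedSpace ℝ E]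
    {S : ℝ → Set E} {t : ℕ → ℝ} (ht : PosNull t) {u : ℕ → E} {p : E} (hu : WeakTendsto u p)
    (huS : ∀ᶠ n in atTop, u n ∈ S (t n)) : p ∈ weakOuterLimit S := by
  obtain ⟨N, hN⟩ := eventually_atTop.1 huS
  exact ⟨fun n => t (n + N), ⟨fun n => ht.1 _, (tendsto_add_atTop_iff_nat N).2 ht.2⟩,
    fun n => u (n + N), (tendsto_add_atTop_iff_nat N).2 hu, fun n => hN _ (Nat.le_add_left _ _)⟩

theorem PosNull.comp {t : ℕ → ℝ} (ht : PosNull t) {φ : ℕ → ℕ} (hφ : Tendsto φ atTop atTop) :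
    PosNull (t ∘ φ) :=
  ⟨fun _ => ht.1 _, ht.2.comp hφ⟩

/-- Along null sequences, a Mosco convergent family of convex epigraphs lies eventually above a
common cone, provided that the limit is nonempty and contains no vertical line. -/
theorem MoscoConvergent.exists_eventually_neg_le {S : ℝ → Set (H × ℝ)} (hM : MoscoConvergent S)
    (hS : ∀ τ, 0 < τ → Convex ℝ (S τ))
    (hup : ∀ τ, 0 < τ → ∀ w a b, (w, a) ∈ S τ → a ≤ b → (w, b) ∈ S τ)
    (hne : (innerLimit S).Nonempty) (hbot : ∀ w, ∃ a, (w, a) ∉ innerLimit S)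
    {t : ℕ → ℝ} (ht : PosNull t) :
    ∃ c : ℝ, ∀ᶠ n in atTop, ∀ p ∈ S (t n), -(c * (‖p.1‖ + 1)) ≤ p.2 := by
  by_contra! hcon
  obtain ⟨φ, hφ, h⟩ := extraction_forall_of_frequently fun n : ℕ => hcon n
  choose w hwS hw using h
  obtain ⟨p, hp⟩ := hne
  have ht' := ht.comp hφ.tendsto_atTop
  obtain ⟨u, hu, hN⟩ := hp _ ht'
  obtain ⟨q, hqC, hq1, hq2⟩ := exists_descending_of_far_below (C := fun n => S (t (φ n)))
    (fun n => hS _ (ht.1 _)) hu (eventually_atTop.2 hN) hwS (fun n => (hw n).le)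
  obtain ⟨a, ha⟩ := hbot p.1
  refine ha (hM (mem_weakOuterLimit_of_eventually ht'
    (weakTendsto_of_tendsto (hq1.prodMk_nhds (tendsto_const_nhds (x := a)))) ?_))
  filter_upwards [hqC, hq2.eventually (eventually_le_atBot a)] with n h1 h2
  exact hup _ (ht.1 _) _ _ _ h1 h2

theorem MoscoConvergent.exists_subseq_tendsto_proxObj_min [CompleteSpace H] {S : ℝ → Set (H × ℝ)}
    (hM : MoscoConvergent S) (hS : ∀ τ, 0 < τ → Convex ℝ (S τ))
    (hup : ∀ τ, 0 < τ → ∀ w a b, (w, a) ∈ S τ → a ≤ b → (w, b) ∈ S τ)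
    (hbot : ∀ w, ∃ a, (w, a) ∉ innerLimit S) (hconv : Convex ℝ (innerLimit S))
    {P : ℝ → H × ℝ} (hP : ∀ τ, 0 < τ → P τ ∈ S τ ∧ ∀ q ∈ S τ, proxObj (P τ) ≤ proxObj q)
    {p : H × ℝ} (hp : p ∈ innerLimit S) (hpm : ∀ q ∈ innerLimit S, proxObj p ≤ proxObj q)
    {t : ℕ → ℝ} (ht : PosNull t) :
    ∃ φ : ℕ → ℕ, Tendsto (fun n => P (t (φ n))) atTop (𝓝 p) := by
  obtain ⟨c, hc⟩ := hM.exists_eventually_neg_le hS hup ⟨p, hp⟩ hbot ht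
  obtain ⟨u, hu, hN⟩ := hp t ht
  have huP : Tendsto (fun n => proxObj (u n)) atTop (𝓝 (proxObj p)) :=
    (continuous_proxObj.tendsto p).comp hu
  set K := proxObj p + 1 with hK
  obtain ⟨N, hN⟩ := eventually_atTop.1 ((hc.and (eventually_atTop.2 hN)).and
    (huP.eventually (gt_mem_nhds (show proxObj p < K by linarith))))
  have hmin : ∀ n ≥ N, proxObj (P (t n)) ≤ proxObj (u n) := fun n hn =>
    (hP _ (ht.1 n)).2 _ (hN n hn).1.2
  have hcone : ∀ n ≥ N, -(c * (‖(P (t n)).1‖ + 1)) ≤ (P (t n)).2 := fun n hn =>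
    (hN n hn).1.1 _ (hP _ (ht.1 n)).1
  set R := √(4 * (K + (c ^ 2 + c)))
  have hR : ∀ n ≥ N, ‖(P (t n)).1‖ ≤ R := fun n hn => by
    refine Real.le_sqrt_of_sq_le ?_
    have := neg_le_proxObj (hcone n hn)
    have := hmin n hn
    have := (hN n hn).2
    linarith
  have ha : ∀ n ≥ N, (P (t n)).2 ∈ Set.Icc (-(|c| * (R + 1))) K := fun n hn => by
    constructor
    · refine le_trans (neg_le_neg ?_) (hcone n hn)
      have := norm_nonneg (P (t n)).1
      have := hR n hn
      exact mul_le_mul (le_abs_self c) (by linarith) (by linarith) (abs_nonneg c)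
    · have h1 := hmin n hn
      have h2 := (hN n hn).2
      have h3 : 0 ≤ ‖(P (t n)).1‖ ^ 2 / 2 := by positivity
      rw [proxObj] at h1
      linarith
  obtain ⟨a', -, φ, hφ, hφa⟩ := tendsto_subseq_of_bounded (Metric.isBounded_Icc _ _)
    (fun n : ℕ => ha (n + N) (Nat.le_add_left _ _))
  obtain ⟨z', ψ, hψ, hz⟩ := exists_subseq_weak_limit (u := fun n => (P (t (φ n + N))).1)
    fun n => hR _ (Nat.le_add_left _ _)
  set χ : ℕ → ℕ := fun n => φ (ψ n) + N with hχ
  have hχt : Tendsto χ atTop atTop :=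
    tendsto_atTop_mono (fun n => Nat.le_add_right _ _) (hφ.comp hψ).tendsto_atTop
  have hχN : ∀ n, N ≤ χ n := fun n => Nat.le_add_left _ _
  have h2 : Tendsto (fun n => (P (t (χ n))).2) atTop (𝓝 a') := hφa.comp hψ.tendsto_atTop
  have hmem : (z', a') ∈ innerLimit S := hM <|
    mem_weakOuterLimit_of_eventually (ht.comp hχt) (weakTendsto_prodMk hz h2)
      (Eventually.of_forall fun _ => (hP _ (ht.1 _)).1)
  -- This bounds the squared distance to `z'`: expand the square and use `‖(P (t (χ n))).1‖ ^ 2 / 2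
  -- ≤ proxObj (u (χ n)) - (P (t (χ n))).2`, by minimality.
  have hlim : Tendsto (fun n => 2 * (proxObj (u (χ n)) - (P (t (χ n))).2 -
      inner ℝ (P (t (χ n))).1 z' + ‖z'‖ ^ 2 / 2)) atTop
      (𝓝 (2 * (proxObj p - a' - inner ℝ z' z' + ‖z'‖ ^ 2 / 2))) :=
    ((((huP.comp hχt).sub h2).sub (hz z')).add_const _).const_mul 2
  have hle : ∀ n, ‖(P (t (χ n))).1 - z'‖ ^ 2 ≤ 2 * (proxObj (u (χ n)) - (P (t (χ n))).2 -
      inner ℝ (P (t (χ n))).1 z' + ‖z'‖ ^ 2 / 2) := fun n => by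
    have := hmin _ (hχN n)
    rw [proxObj] at this
    rw [norm_sub_sq_real]
    linarith
  -- The limit of the bound is twice `proxObj p - proxObj (z', a')`. Its nonnegativity makes `(z',
  -- a')` a minimizer, hence equal to `p`; the bound then tends to zero.
  have hge := ge_of_tendsto' hlim fun n => (sq_nonneg _).trans (hle n)
  rw [real_inner_self_eq_norm_sq] at hge hlim
  have hzp : (z', a') = p := eq_of_isMinOn_proxObj hconv hp hmem hpm (by
    simp only [proxObj] at hge ⊢; linarith)
  have hz0 : 2 * (proxObj p - a' - ‖z'‖ ^ 2 + ‖z'‖ ^ 2 / 2) = 0 := by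
    rw [← hzp, proxObj]; ring
  rw [hz0] at hlim
  have hsq := squeeze_zero (fun n => sq_nonneg _) hle hlim
  have hnorm : Tendsto (fun n => ‖(P (t (χ n))).1 - z'‖) atTop (𝓝 0) := by
    simpa [Function.comp_def, Real.sqrt_sq] using (Real.continuous_sqrt.tendsto 0).comp hsq
  refine ⟨χ, hzp ▸ ?_⟩
  exact (tendsto_iff_norm_sub_tendsto_zero.2 hnorm).prodMk_nhds h2

/-- Mosco convergence of epigraphs implies the strong convergence of the proximal points of the
origin together with their values. -/
theorem MoscoConvergent.tendsto_proxObj_min [CompleteSpace H] {S : ℝ → Set (H × ℝ)}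
    (hM : MoscoConvergent S) (hS : ∀ τ, 0 < τ → Convex ℝ (S τ))
    (hup : ∀ τ, 0 < τ → ∀ w a b, (w, a) ∈ S τ → a ≤ b → (w, b) ∈ S τ)
    (hbot : ∀ w, ∃ a, (w, a) ∉ innerLimit S) (hconv : Convex ℝ (innerLimit S))
    {P : ℝ → H × ℝ} (hP : ∀ τ, 0 < τ → P τ ∈ S τ ∧ ∀ q ∈ S τ, proxObj (P τ) ≤ proxObj q)
    {p : H × ℝ} (hp : p ∈ innerLimit S) (hpm : ∀ q ∈ innerLimit S, proxObj p ≤ proxObj q) :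
    Tendsto P (𝓝[>] 0) (𝓝 p) := by
  refine tendsto_of_subseq_tendsto fun s hs => ?_
  obtain ⟨hs0, hspos⟩ := tendsto_nhdsWithin_iff.1 hs
  obtain ⟨N, hN⟩ := eventually_atTop.1 hspos
  obtain ⟨φ, hφ⟩ := hM.exists_subseq_tendsto_proxObj_min hS hup hbot hconv hP hp hpm
    (t := fun n => s (n + N))
    ⟨fun n => hN _ (Nat.le_add_left _ _), (tendsto_add_atTop_iff_nat N).2 hs0⟩
  exact ⟨fun n => φ n + N, hφ⟩

theorem convex_innerLimit {E : Type*} [NormedAddCommGroup E] [NormedSpace ℝ E] {S : ℝ → Set E}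
    (hS : ∀ τ, 0 < τ → Convex ℝ (S τ)) : Convex ℝ (innerLimit S) := by
  intro p hp q hq a b ha hb hab t ht
  obtain ⟨u, hu, N, hN⟩ := hp t ht
  obtain ⟨w, hw, N', hN'⟩ := hq t ht
  exact ⟨fun n => a • u n + b • w n, (hu.const_smul a).add (hw.const_smul b), max N N',
    fun n hn => hS _ (ht.1 n) (hN n (le_of_max_le_left hn)) (hN' n (le_of_max_le_right hn)) ha hb hab⟩

end Hilbert

/-! ### From epigraphs back to functions and difference quotients -/

section Functions

variable {H : Type*} [NormedAddCommGroup H] [InnerProductSpace ℝ H]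

omit [NormedAddCommGroup H] [InnerProductSpace ℝ H] in
theorem mem_epi_mono {g : H → EReal} {w : H} {a b : ℝ} (h : (w, a) ∈ epi g) (hab : a ≤ b) :
    (w, b) ∈ epi g :=
  le_trans (show g w ≤ (a : EReal) from h) (EReal.coe_le_coe_iff.2 hab)

omit [NormedAddCommGroup H] [InnerProductSpace ℝ H] in
theorem eq_bot_of_forall_mem_epi {g : H → EReal} {w : H} (h : ∀ a : ℝ, (w, a) ∈ epi g) :
    g w = ⊥ := by
  refine (EReal.eq_bot_iff_forall_lt _).2 fun a => ?_
  exact lt_of_le_of_lt (show g w ≤ ((a - 1 : ℝ) : EReal) from h (a - 1))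
    (EReal.coe_lt_coe_iff.2 (by linarith))

omit [NormedAddCommGroup H] [InnerProductSpace ℝ H] in
theorem coe_le_of_forall_mem_epi {g : H → EReal} {w : H} {c : ℝ}
    (h : ∀ a : ℝ, (w, a) ∈ epi g → c ≤ a) : (c : EReal) ≤ g w :=
  EReal.le_of_forall_lt_iff_le.1 fun a ha => EReal.coe_le_coe_iff.2 (h a ha.le)

omit [NormedAddCommGroup H] [InnerProductSpace ℝ H] in
theorem nonempty_epi {g : H → EReal} (h : ∃ w, g w < ⊤) : (epi g).Nonempty := by
  obtain ⟨w, hw⟩ := h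
  obtain ⟨a, ha, -⟩ := EReal.lt_iff_exists_real_btwn.1 hw
  exact ⟨(w, a), ha.le⟩

theorem IsGammaZero.exists_notMem_epi {g : H → EReal} (hg : IsGammaZero g) (w : H) :
    ∃ a, (w, a) ∉ epi g := by
  by_contra! h
  exact hg.ne_bot w (eq_bot_of_forall_mem_epi h)

theorem IsGammaZero.exists_proxObj_min [CompleteSpace H] {g : H → EReal} (hg : IsGammaZero g) :
    ∃ p ∈ epi g, ∀ q ∈ epi g, proxObj p ≤ proxObj q := by
  have hne := nonempty_epi hg.proper
  obtain ⟨c, hc⟩ := exists_forall_neg_le_of_isClosed hg.convex hg.lsc hne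
    (fun _ _ _ => mem_epi_mono) hg.exists_notMem_epi
  refine exists_isMinOn_proxObj hg.convex hg.lsc hne ⟨-(c ^ 2 + c), ?_⟩
  rintro _ ⟨p, hp, rfl⟩
  have := neg_le_proxObj (hc p hp)
  have : 0 ≤ ‖p.1‖ ^ 2 / 4 := by positivity
  linarith

theorem isSupportingHyperplane_of_proxObj_min {g : H → EReal} (hg : Convex ℝ (epi g))
    {p : H × ℝ} (hp : p ∈ epi g) (hpm : ∀ q ∈ epi g, proxObj p ≤ proxObj q) :
    IsSupportingHyperplane g p.1 (-p.1) (p.2 + ‖p.1‖ ^ 2) := by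
  have h : ∀ w, ((inner ℝ (-p.1) w + (p.2 + ‖p.1‖ ^ 2) : ℝ) : EReal) ≤ g w := fun w =>
    coe_le_of_forall_mem_epi fun a ha => inner_add_le_of_isMinOn_proxObj hg hp hpm ha
  refine ⟨h, le_antisymm ?_ (h _)⟩
  have e : inner ℝ (-p.1) p.1 + (p.2 + ‖p.1‖ ^ 2) = p.2 := by
    rw [inner_neg_left, real_inner_self_eq_norm_sq]; ring
  rw [e]
  exact hp

/-- Since `f τ x` is finite, the quotient's epigraph is an affine preimage of that of `f τ`;
closedness and convexity transfer through it. -/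
theorem mem_epi_secondDiffQuot {f : ℝ → H → EReal} {x v : H} {τ r : ℝ} (hτ : 0 < τ)
    (hr : f τ x = (r : EReal)) (w : H) (a : ℝ) :
    (w, a) ∈ epi (secondDiffQuot f x v τ) ↔
      (x + τ • w, τ ^ 2 * a + τ * inner ℝ v w + r) ∈ epi (f τ) := by
  have h1 : (0 : EReal) < ((τ ^ 2 : ℝ) : EReal) := EReal.coe_pos.2 (by positivity)
  change secondDiffQuot f x v τ w ≤ (a : EReal) ↔ f τ (x + τ • w) ≤ _
  rw [secondDiffQuot, hr, EReal.div_le_iff_le_mul h1 (EReal.coe_ne_top _),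
    EReal.sub_le_iff_le_add (Or.inl (EReal.coe_ne_bot _)) (Or.inl (EReal.coe_ne_top _)),
    EReal.sub_le_iff_le_add (Or.inl (EReal.coe_ne_bot _)) (Or.inl (EReal.coe_ne_top _))]
  simp only [EReal.coe_add, EReal.coe_mul]

theorem IsGammaZero.secondDiffQuot {f : ℝ → H → EReal} {x v : H} {τ : ℝ} (hτ : 0 < τ)
    (hf : IsGammaZero (f τ)) (hx : f τ x ≠ ⊤) : IsGammaZero (secondDiffQuot f x v τ) := by
  obtain ⟨r, hr⟩ : ∃ r : ℝ, f τ x = r := ⟨(f τ x).toReal, (EReal.coe_toReal hx (hf.ne_bot x)).symm⟩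
  have hmem := mem_epi_secondDiffQuot (v := v) hτ hr
  have hτ2 : τ ^ 2 ≠ 0 := by positivity
  have hepi : epi (EpiDiff.secondDiffQuot f x v τ) =
      (fun p : H × ℝ => (x + τ • p.1, τ ^ 2 * p.2 + τ * inner ℝ v p.1 + r)) ⁻¹' epi (f τ) :=
    Set.ext fun p => hmem p.1 p.2
  refine ⟨fun w hw => hf.ne_bot (x + τ • w) (eq_bot_of_forall_mem_epi fun a => ?_), ⟨0, ?_⟩, ?_, ?_⟩
  -- This height is the one that the affine map sends to `a`.
  · have h := (hmem w ((a - r - τ * inner ℝ v w) / τ ^ 2)).1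
      (show EpiDiff.secondDiffQuot f x v τ w ≤ _ from hw ▸ bot_le)
    convert h using 2
    field_simp
    ring
  · have h := (hmem 0 0).2 (show f τ _ ≤ _ by simp [hr])
    exact lt_of_le_of_lt (show EpiDiff.secondDiffQuot f x v τ 0 ≤ ((0 : ℝ) : EReal) from h)
      (EReal.coe_lt_top 0)
  · rw [hepi]
    exact hf.lsc.preimage (by fun_prop)
  · intro p hp q hq a b ha hb hab
    rw [hepi, Set.mem_preimage] at hp hq ⊢
    have h := hf.convex hp hq ha hb hab
    convert h using 1
    obtain rfl : b = 1 - a := by linarith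
    refine Prod.ext ?_ ?_
    · simp only [Prod.fst_add, Prod.smul_fst]
      module
    · simp only [Prod.snd_add, Prod.smul_snd, Prod.fst_add, Prod.smul_fst, smul_eq_mul,
        inner_add_right, inner_smul_right]
      ring

theorem isGammaZero_epiLimit {F : ℝ → H → EReal} (hF : ∀ τ, 0 < τ → Convex ℝ (epi (F τ)))
    (h : AdmitsConvergentSupportingHyperplane F) : IsGammaZero (epiLimit F) := by
  obtain ⟨z, ξ, β, z₀, ξ₀, β₀, hz, hξ, hβ, hs⟩ := h
  have hnull : ∀ t, PosNull t → Tendsto t atTop (𝓝[>] 0) := fun t ht =>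
    tendsto_nhdsWithin_iff.2 ⟨ht.2, Eventually.of_forall ht.1⟩
  refine ⟨fun w hw => ?_, ⟨z₀, ?_⟩, ?_, ?_⟩
  -- At a point of value `⊥` every height is in the limit, even one unit below the limiting affine
  -- minorant.
  · have hmem : (w, inner ℝ ξ₀ w + β₀ - 1) ∈ innerLimit fun τ => epi (F τ) := by
      rw [← epi_epiLimit]
      exact (show epiLimit F w ≤ _ from hw ▸ bot_le)
    have ht : PosNull (fun n : ℕ => 1 / ((n : ℝ) + 1)) :=
      ⟨fun n => by positivity, tendsto_one_div_add_atTop_nhds_zero_nat⟩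
    obtain ⟨u, hu, N, hN⟩ := hmem _ ht
    have hu1 : Tendsto (fun n => (u n).1) atTop (𝓝 w) := (continuous_fst.tendsto _).comp hu
    have hu2 := (continuous_snd.tendsto _).comp hu
    have h1 := ((hξ.comp (hnull _ ht)).inner hu1 (𝕜 := ℝ)).add (hβ.comp (hnull _ ht))
    have := le_of_tendsto_of_tendsto h1 hu2 (by
      filter_upwards [eventually_ge_atTop N] with n hn
      exact EReal.coe_le_coe_iff.1 (((hs _ (ht.1 n)).1 _).trans (hN n hn)))
    simp only at this
    linarith
  · have hmem : (z₀, inner ℝ ξ₀ z₀ + β₀) ∈ epi (epiLimit F) := by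
      rw [epi_epiLimit]
      intro t ht
      have h1 := hz.comp (hnull t ht)
      exact ⟨_, h1.prodMk_nhds (((hξ.comp (hnull t ht)).inner h1 (𝕜 := ℝ)).add
        (hβ.comp (hnull t ht))), 0, fun n _ => (hs _ (ht.1 n)).2.le⟩
    exact lt_of_le_of_lt (show epiLimit F z₀ ≤ ((inner ℝ ξ₀ z₀ + β₀ : ℝ) : EReal) from hmem)
      (EReal.coe_lt_top _)
  · rw [epi_epiLimit]
    exact isClosed_innerLimit _
  · rw [epi_epiLimit]
    exact convex_innerLimit hF

theorem admitsConvergentSupportingHyperplane_of_isGammaZero_epiLimit [CompleteSpace H]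
    {F : ℝ → H → EReal} (hF : ∀ τ, 0 < τ → IsGammaZero (F τ)) (hd : EpiConvergent F)
    (h : IsGammaZero (epiLimit F)) : AdmitsConvergentSupportingHyperplane F := by
  have hex : ∀ τ, ∃ p, 0 < τ → p ∈ epi (F τ) ∧ ∀ q ∈ epi (F τ), proxObj p ≤ proxObj q := by
    intro τ
    by_cases hτ : 0 < τ
    · obtain ⟨p, hp⟩ := (hF τ hτ).exists_proxObj_min
      exact ⟨p, fun _ => hp⟩
    · exact ⟨0, fun h => absurd h hτ⟩
  choose P hP using hex
  obtain ⟨p, hp, hpm⟩ := h.exists_proxObj_min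
  have hbot := h.exists_notMem_epi
  have hconv := h.convex
  rw [epi_epiLimit] at hp hpm hconv
  simp only [epi_epiLimit] at hbot
  have hlim : Tendsto P (𝓝[>] 0) (𝓝 p) := MoscoConvergent.tendsto_proxObj_min hd
    (fun τ hτ => (hF τ hτ).convex) (fun _ _ _ _ _ => mem_epi_mono) hbot hconv hP hp hpm
  have h1 : Tendsto (fun τ => (P τ).1) (𝓝[>] 0) (𝓝 p.1) := (continuous_fst.tendsto p).comp hlim
  have h2 : Tendsto (fun τ => (P τ).2) (𝓝[>] 0) (𝓝 p.2) := (continuous_snd.tendsto p).comp hlim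
  -- The intercept makes the affine function of slope `-(P τ).1` take the value `(P τ).2` at `(P
  -- τ).1`.
  exact ⟨fun τ => (P τ).1, fun τ => -(P τ).1, fun τ => (P τ).2 + ‖(P τ).1‖ ^ 2, _, _, _,
    h1, h1.neg, h2.add (h1.norm.pow 2), fun τ hτ =>
      isSupportingHyperplane_of_proxObj_min (hF τ hτ).convex (hP τ hτ).1 (hP τ hτ).2⟩

end Functions

end EpiDiff

theorem mainTheorem4 {H : Type*} [NormedAddCommGroup H] [InnerProductSpace ℝ H] [CompleteSpace H]
    (f : ℝ → H → EReal) (hf : EpiDiff.IsParamGammaZero f)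
    (x : H) (hx : x ∈ EpiDiff.finiteDomain f)
    (v : H) (hv : v ∈ EpiDiff.subdiff (f 0) x)
    (hd : EpiDiff.TwiceEpiDifferentiableAt f x v) :
    EpiDiff.IsGammaZero (EpiDiff.secondEpiDeriv f x v) ↔
      EpiDiff.AdmitsConvergentSupportingHyperplane (EpiDiff.secondDiffQuot f x v) := by
  have hF : ∀ τ, 0 < τ → EpiDiff.IsGammaZero (EpiDiff.secondDiffQuot f x v τ) := fun τ hτ =>
    (hf τ hτ.le).secondDiffQuot hτ (hx τ hτ.le).2
  exact ⟨EpiDiff.admitsConvergentSupportingHyperplane_of_isGammaZero_epiLimit hF hd,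
    EpiDiff.isGammaZero_epiLimit fun τ hτ => (hF τ hτ).convex⟩
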